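/- Let $\mathbb{R}^d$ carry the Euclidean norm and matrices the induced operator norm, and let $A\in\mathbb{R}^{m\times n}$ have full column rank. Write $\mathbb{R}^m_{+}$ and $\mathbb{R}^m_{++}$ for the sets of vectors with nonnegative, respectively positive, entries. Define, with values in $[0,\infty]$ (and $1/0=\infty$, $1/\infty=0$, $\inf\emptyset=\infty$, $\sup\emptyset=0$), \[ \chi(A)=\sup_{D}\ \|(A^{\mathsf T}DA)^{-1}A^{\mathsf T}D\|, \] the supremum being over all diagonal $m\times m$ matrices $D$ with positive diagonal entries; \[ H(A)=\sup\left\{\frac{\operatorname{dist}(x,P_A(b))}{\|(Ax-b)_+\|}\;:\; b\in A(\mathbb{R}^n)+\mathbb{R}^m_+,\ x\in\mathbb{R}^n\setminus P_A(b)\right\},\qquad P_A(b)=\{x\in\mathbb{R}^n: Ax\le b\}, \] where $(\cdot)_+$ is the componentwise positive part and $\operatorname{dist}(x,P)=\inf_{v\in P}\|x-v\|$; and \[ \mathcal{R}(A)=\inf\{\|\Delta A\| : \Delta A\in\mathbb{R}^{m\times n},\ (A+\Delta A)(\mathbb{R}^n)\cap\mathbb{R}^m_{++}=\emptyset\}.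 \] (i) If $A(\mathbb{R}^n)\cap\mathbb{R}^m_{++}\neq\emptyset$, then $H(A)$ is finite and $H(A)=1/\mathcal{R}(A)$. (ii) If all rows of $A$ are nonzero, then $\chi(A)$ is finite and \[ \chi(A)=\max_{S}\ \frac{1}{\mathcal{R}(SA)}, \] where the maximum is over all signature matrices $S=\operatorname{Diag}(s)$, $s\in\{-1,1\}^m$, such that $SA(\mathbb{R}^n)\cap\mathbb{R}^m_{++}\neq\emptyset$; in particular at least one such $S$ exists and the maximum is attained. -/

import Mathlib

/- Matrices carry the operator norm induced by the Euclidean norms. -/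
open scoped Matrix Matrix.Norms.L2Operator ENNReal

namespace ChiHoffman

variable {m n : ℕ}

/-- The set of diagonal `m × m` matrices with positive diagonal entries. -/
def posDiag (m : ℕ) : Set (Matrix (Fin m) (Fin m) ℝ) :=
  {D | ∃ d : Fin m → ℝ, (∀ i, 0 < d i) ∧ D = Matrix.diagonal d}

/-- The set of `m × m` signature matrices: diagonal matrices with entries `1` or `-1` on the
diagonal. -/
def signatures (m : ℕ) : Set (Matrix (Fin m) (Fin m) ℝ) :=
  {S | ∃ s : Fin m → ℝ, (∀ i, s i = -1 ∨ s i = 1) ∧ S = Matrix.diagonal s}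

/-- The image `A(ℝⁿ)` contains a vector all of whose entries are positive. -/
def ImageMeetsPos (A : Matrix (Fin m) (Fin n) ℝ) : Prop :=
  (Set.range (fun x : Fin n → ℝ => A *ᵥ x) ∩ {y | ∀ i, 0 < y i}).Nonempty

/-- The weighted pseudo-inverse `(Aᵀ D A)⁻¹ Aᵀ D`. -/
noncomputable def weightedPinv (A : Matrix (Fin m) (Fin n) ℝ) (D : Matrix (Fin m) (Fin m) ℝ) :
    Matrix (Fin n) (Fin m) ℝ :=
  (Aᵀ * D * A)⁻¹ * Aᵀ * D

/-- The chi constant: the supremum, in `[0, ∞]`, of the operator norms of the weighted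
pseudo-inverses over all positive diagonal weights. -/
noncomputable def chi (A : Matrix (Fin m) (Fin n) ℝ) : ℝ≥0∞ :=
  ⨆ D ∈ posDiag m, ‖weightedPinv A D‖ₑ

/-- The polyhedron `{x ∈ ℝⁿ : A x ≤ b}`. -/
def polyhedron (A : Matrix (Fin m) (Fin n) ℝ) (b : Fin m → ℝ) :
    Set (EuclideanSpace ℝ (Fin n)) :=
  {x | A *ᵥ x.ofLp ≤ b}

/-- The set `A(ℝⁿ) + ℝᵐ₊` of right-hand sides. -/
def rightHandSides (A : Matrix (Fin m) (Fin n) ℝ) : Set (Fin m → ℝ) :=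
  {b | ∃ (z : Fin n → ℝ) (u : Fin m → ℝ), 0 ≤ u ∧ b = A *ᵥ z + u}

/-- The Hoffman constant: the supremum, in `[0, ∞]`, of the ratios
`dist(x, P_A(b)) / ‖(A x - b)₊‖` over all `b ∈ A(ℝⁿ) + ℝᵐ₊` and all `x ∉ P_A(b)`. -/
noncomputable def hoffman (A : Matrix (Fin m) (Fin n) ℝ) : ℝ≥0∞ :=
  ⨆ b ∈ rightHandSides A, ⨆ x ∈ (polyhedron A b)ᶜ,
    Metric.infEDist x (polyhedron A b) / ‖WithLp.toLp 2 ((A *ᵥ x.ofLp - b)⁺)‖ₑ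

/-- Renegar's distance to infeasibility: the infimum, in `[0, ∞]`, of the operator norms of the
perturbations `E` such that the image of `A + E` contains no vector with positive entries. -/
noncomputable def renegar (A : Matrix (Fin m) (Fin n) ℝ) : ℝ≥0∞ :=
  ⨅ (E : Matrix (Fin m) (Fin n) ℝ) (_ : ¬ ImageMeetsPos (A + E)), ‖E‖ₑ

end ChiHoffman

/-! All three constants reduce to one quantity, `dualGain A`, the supremum of `‖y‖ / ‖Aᵀ y‖` over `y
≥ 0`.

By Gordan's alternative, `A + E` is infeasible exactly when `Eᵀ y = -Aᵀ y` for some nonzero `y ≥ 0`.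
The least norm of such an `E` for a given `y` is `‖Aᵀ y‖ / ‖y‖`, so `one_div_renegar` holds. A
separation argument (`exists_mulVec_le_of_forall_norm_le`) bounds the Hoffman constant by the gain,
and the systems `A v ≤ -y` seen from `x = 0` give the converse.

For `chi`, the transposed pseudo-inverse sends `Aᵀ D A z` to `D A z`, so its norm is the gain over
the vectors `w = D A z`. These share the sign pattern of `A z`; writing `w = S y` with `y ≥ 0`
preserves the norm and turns `Aᵀ w` into `(S A)ᵀ y`. The feasible signatures cover all patterns that
occur, and each such `S` lets every `y > 0` occur. -/

namespace ChiHoffman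

/-! ### Euclidean and operator norms -/

section Norms

variable {m n : ℕ}

lemma norm_toLp_mulVec_le (A : Matrix (Fin m) (Fin n) ℝ) (x : Fin n → ℝ) :
    ‖WithLp.toLp 2 (A *ᵥ x)‖ ≤ ‖A‖ * ‖WithLp.toLp 2 x‖ :=
  A.l2_opNorm_mulVec (WithLp.toLp 2 x)

lemma l2_opNorm_le_of_forall (A : Matrix (Fin m) (Fin n) ℝ) {c : ℝ} (hc : 0 ≤ c)
    (h : ∀ x, ‖WithLp.toLp 2 (A *ᵥ x)‖ ≤ c * ‖WithLp.toLp 2 x‖) : ‖A‖ ≤ c := by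
  rw [Matrix.l2_opNorm_def]
  exact ContinuousLinearMap.opNorm_le_bound _ hc fun x => h x.ofLp

lemma l2_opNorm_transpose (A : Matrix (Fin m) (Fin n) ℝ) : ‖Aᵀ‖ = ‖A‖ := by
  rw [← Matrix.conjTranspose_eq_transpose_of_trivial, Matrix.l2_opNorm_conjTranspose]

lemma dotProduct_le_norm_mul_norm (x y : Fin n → ℝ) :
    x ⬝ᵥ y ≤ ‖WithLp.toLp 2 x‖ * ‖WithLp.toLp 2 y‖ := by
  have h := real_inner_le_norm (WithLp.toLp 2 y : EuclideanSpace ℝ (Fin n)) (WithLp.toLp 2 x)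
  rw [EuclideanSpace.inner_eq_star_dotProduct, mul_comm] at h
  simpa using h

lemma dotProduct_self_eq_norm_sq (x : Fin n → ℝ) : x ⬝ᵥ x = ‖WithLp.toLp 2 x‖ ^ 2 := by
  rw [← real_inner_self_eq_norm_sq, EuclideanSpace.inner_eq_star_dotProduct]
  simp

lemma norm_toLp_le_sum {y : Fin n → ℝ} (hy : 0 ≤ y) : ‖WithLp.toLp 2 y‖ ≤ ∑ i, y i := by
  have hs : 0 ≤ ∑ i, y i := Finset.sum_nonneg fun i _ => hy i
  refine le_of_sq_le_sq ?_ hs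
  rw [← dotProduct_self_eq_norm_sq, sq, Finset.sum_mul]
  exact Finset.sum_le_sum fun i _ => mul_le_mul_of_nonneg_left
    (Finset.single_le_sum (fun j _ => hy j) (Finset.mem_univ i)) (hy i)

lemma strongDual_apply_eq_dotProduct (f : StrongDual ℝ (Fin n → ℝ)) (v : Fin n → ℝ) :
    f v = v ⬝ᵥ fun i => f (Pi.single i 1) := by
  conv_lhs => rw [pi_eq_sum_univ' v]
  simp [dotProduct]

lemma dotProduct_mulVec_eq (A : Matrix (Fin m) (Fin n) ℝ) (x : Fin n → ℝ) (y : Fin m → ℝ) :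
    (A *ᵥ x) ⬝ᵥ y = x ⬝ᵥ (Aᵀ *ᵥ y) := by
  rw [dotProduct_comm, Matrix.dotProduct_mulVec, Matrix.mulVec_transpose, dotProduct_comm]

end Norms

/-! ### Theorems of the alternative by separation -/

section Alternative

variable {m n : ℕ}

/-- Gordan's theorem of the alternative. -/
lemma exists_transpose_mulVec_eq_zero (A : Matrix (Fin m) (Fin n) ℝ) (h : ¬ ImageMeetsPos A) :
    ∃ y : Fin m → ℝ, 0 ≤ y ∧ y ≠ 0 ∧ Aᵀ *ᵥ y = 0 := by
  have hopen : IsOpen {y : Fin m → ℝ | ∀ i, 0 < y i} := by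
    simp only [Set.ofPred_forall]
    exact isOpen_iInter_of_finite fun i => isOpen_lt continuous_const (continuous_apply i)
  have hconv : Convex ℝ {y : Fin m → ℝ | ∀ i, 0 < y i} := by
    intro a ha b hb s t hs ht hst i
    have := convex_Ioi (𝕜 := ℝ) (0 : ℝ) (ha i) (hb i) hs ht hst
    simpa using this
  have hrange : Convex ℝ (Set.range fun x : Fin n → ℝ => A *ᵥ x) :=
    (LinearMap.range A.mulVecLin).convex
  obtain ⟨f, u, hlt, hle⟩ := geometric_hahn_banach_open hconv hopen hrange
    (by
      rw [Set.disjoint_iff_inter_eq_empty, Set.inter_comm]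
      exact Set.not_nonempty_iff_eq_empty.mp h)
  set p : Fin m → ℝ := fun i => f (Pi.single i 1) with hp
  have hf : ∀ v, f v = v ⬝ᵥ p := strongDual_apply_eq_dotProduct f
  have hle' : ∀ x, u ≤ x ⬝ᵥ (Aᵀ *ᵥ p) := fun x => by
    rw [← dotProduct_mulVec_eq, ← hf]; exact hle _ ⟨x, rfl⟩
  have hu : u ≤ 0 := by simpa using hle' 0
  have hone : f 1 < 0 := (hlt 1 fun i => by simp).trans_le hu
  have hzero : Aᵀ *ᵥ p = 0 := by
    by_contra hne
    have hpos : 0 < (Aᵀ *ᵥ p) ⬝ᵥ (Aᵀ *ᵥ p) :=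
      lt_of_le_of_ne (by rw [dotProduct_self_eq_norm_sq]; positivity)
        (Ne.symm (by rwa [Ne, dotProduct_self_eq_zero]))
    -- A linear form bounded below vanishes: at this multiple its value is `u - 1`.
    have := hle' (((u - 1) / ((Aᵀ *ᵥ p) ⬝ᵥ (Aᵀ *ᵥ p))) • (Aᵀ *ᵥ p))
    rw [smul_dotProduct, smul_eq_mul, div_mul_cancel₀ _ hpos.ne'] at this
    linarith
  have hnonpos : ∀ i, p i ≤ 0 := by
    intro i
    by_contra! hi
    -- Moving from `1` along a coordinate stays in the open orthant, where `f < u ≤ 0`; this `t`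
    -- would raise `f` to `1`.
    obtain ⟨t, ht0, ht⟩ : ∃ t : ℝ, 0 < t ∧ 0 < f 1 + t * p i :=
      ⟨(1 - f 1) / p i, div_pos (by linarith) hi, by rw [div_mul_cancel₀ _ hi.ne']; linarith⟩
    have h1 := hlt (1 + t • Pi.single i 1) fun j => by
      have : (0 : ℝ) ≤ (Pi.single i 1 : Fin m → ℝ) j := by
        rw [Pi.single_apply]; split_ifs <;> norm_num
      simp only [Pi.add_apply, Pi.one_apply, Pi.smul_apply, smul_eq_mul]
      positivity
    rw [map_add, map_smul, smul_eq_mul] at h1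
    change f 1 + t * p i < u at h1
    linarith
  refine ⟨-p, fun i => by simpa using hnonpos i, fun h0 => ?_,
    by rw [Matrix.mulVec_neg, hzero, neg_zero]⟩
  rw [hf, neg_eq_zero.mp h0, dotProduct_zero] at hone
  exact hone.false

lemma not_imageMeetsPos_of_transpose_mulVec_eq_zero (A : Matrix (Fin m) (Fin n) ℝ)
    {y : Fin m → ℝ} (hy : 0 ≤ y) (hy0 : y ≠ 0) (h : Aᵀ *ᵥ y = 0) : ¬ ImageMeetsPos A := by
  rintro ⟨_, ⟨x, rfl⟩, hx⟩
  obtain ⟨i, hi⟩ := Function.ne_iff.mp hy0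
  have h1 : (A *ᵥ x) ⬝ᵥ y = 0 := by rw [dotProduct_mulVec_eq, h, dotProduct_zero]
  have h2 : 0 < (A *ᵥ x) ⬝ᵥ y := Finset.sum_pos' (fun j _ => mul_nonneg (hx j).le (hy j))
    ⟨i, Finset.mem_univ i, mul_pos (hx i) (lt_of_le_of_ne (hy i) (Ne.symm hi))⟩
  exact h2.ne' h1

/-- If `‖y‖ ≤ c ‖Aᵀ y‖` for all `y ≥ 0`, every system `A v ≤ b` has a solution of norm at most
`c ‖(-b)⁺‖`. -/
lemma exists_mulVec_le_of_forall_norm_le (A : Matrix (Fin m) (Fin n) ℝ) {c : ℝ} (hc : 0 ≤ c)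
    (h : ∀ y : Fin m → ℝ, 0 ≤ y → ‖WithLp.toLp 2 y‖ ≤ c * ‖WithLp.toLp 2 (Aᵀ *ᵥ y)‖)
    (b : Fin m → ℝ) :
    ∃ v : Fin n → ℝ, A *ᵥ v ≤ b ∧ ‖WithLp.toLp 2 v‖ ≤ c * ‖WithLp.toLp 2 ((-b)⁺)‖ := by
  set r : ℝ := c * ‖WithLp.toLp 2 ((-b)⁺)‖ with hr
  have hr0 : 0 ≤ r := by positivity
  by_contra! hno
  let L : EuclideanSpace ℝ (Fin n) →L[ℝ] (Fin m → ℝ) :=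
    (A.mulVecLin ∘ₗ (WithLp.linearEquiv 2 ℝ (Fin n → ℝ)).toLinearMap).toContinuousLinearMap
  have hL : ∀ v, L v = A *ᵥ v.ofLp := fun v => rfl
  obtain ⟨f, u, w, hlt, huw, hgt⟩ := geometric_hahn_banach_compact_closed
    (s := L '' Metric.closedBall 0 r) (t := Set.Iic b)
    ((convex_closedBall 0 r).linear_image L.toLinearMap)
    ((isCompact_closedBall 0 r).image L.continuous) (convex_Iic b) isClosed_Iic
    (by
      rw [Set.disjoint_left]
      rintro _ ⟨v, hv, rfl⟩ hvb
      exact absurd (mem_closedBall_zero_iff.mp hv) (not_le.mpr (hno v.ofLp hvb)))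
  set p : Fin m → ℝ := fun i => f (Pi.single i 1) with hp
  have hf : ∀ v, f v = v ⬝ᵥ p := strongDual_apply_eq_dotProduct f
  have hb : w < b ⬝ᵥ p := by rw [← hf]; exact hgt b (Set.mem_Iic.mpr le_rfl)
  have hnonpos : ∀ i, p i ≤ 0 := by
    intro i
    by_contra! hi
    -- Lowering this coordinate of `b` stays in `Set.Iic b` but brings `f` down to exactly `w`.
    have h1 := hgt (b - ((f b - w) / p i) • Pi.single i 1) (by
      refine Set.mem_Iic.mpr (sub_le_self _ (smul_nonneg (div_nonneg ?_ hi.le) ?_))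
      · rw [hf]; linarith
      · exact Pi.single_nonneg.mpr zero_le_one)
    rw [map_sub, map_smul, smul_eq_mul] at h1
    change w < f b - (f b - w) / p i * p i at h1
    rw [div_mul_cancel₀ _ hi.ne'] at h1
    linarith
  -- The maximum of `f` over the image of the ball, attained in the direction `Aᵀ p`.
  have hball : r * ‖WithLp.toLp 2 (Aᵀ *ᵥ p)‖ ≤ u := by
    set q := Aᵀ *ᵥ p with hq
    rcases eq_or_ne q 0 with h0 | h0
    · have := hlt (L 0) ⟨0, by simpa using hr0, rfl⟩
      rw [map_zero, map_zero] at this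
      simpa [h0] using this.le
    · have hqn : 0 < ‖WithLp.toLp 2 q‖ := norm_pos_iff.mpr (by simpa using h0)
      have := hlt (L ((r / ‖WithLp.toLp 2 q‖) • WithLp.toLp 2 q)) ⟨_, by
        rw [mem_closedBall_zero_iff, norm_smul, Real.norm_of_nonneg (by positivity),
          div_mul_cancel₀ _ hqn.ne'], rfl⟩
      rw [hf, hL, dotProduct_mulVec_eq, ← hq, WithLp.ofLp_smul, smul_dotProduct,
        dotProduct_self_eq_norm_sq, smul_eq_mul] at this
      refine le_trans (le_of_eq ?_) this.le
      field_simp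
  -- With `y = -p` the contradiction is `b ⬝ᵥ p ≤ ‖(-b)⁺‖ ‖p‖ ≤ r ‖Aᵀ p‖ ≤ u < w < b ⬝ᵥ p`.
  have hlow : (-b) ⬝ᵥ (-p) ≤ ‖WithLp.toLp 2 ((-b)⁺)‖ * ‖WithLp.toLp 2 (-p)‖ :=
    le_trans (dotProduct_le_dotProduct_of_nonneg_right (le_posPart (-b))
      (fun i => by simpa using hnonpos i)) (dotProduct_le_norm_mul_norm _ _)
  have hbound := mul_le_mul_of_nonneg_left (h (-p) fun i => by simpa using hnonpos i)
    (norm_nonneg (WithLp.toLp 2 ((-b)⁺)))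
  rw [neg_dotProduct_neg] at hlow
  simp only [Matrix.mulVec_neg, WithLp.toLp_neg, norm_neg] at hbound hlow
  have : ‖WithLp.toLp 2 ((-b)⁺)‖ * (c * ‖WithLp.toLp 2 (Aᵀ *ᵥ p)‖)
      = r * ‖WithLp.toLp 2 (Aᵀ *ᵥ p)‖ := by rw [hr]; ring
  linarith

end Alternative

/-! ### The dual gain and the distance to infeasibility -/

section Gain

variable {m n : ℕ}

/-- The supremum of the ratios `‖y‖ / ‖Aᵀ y‖` over all `y ≥ 0`. -/
noncomputable def dualGain (A : Matrix (Fin m) (Fin n) ℝ) : ℝ≥0∞ :=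
  ⨆ (y : Fin m → ℝ) (_ : 0 ≤ y), ‖WithLp.toLp 2 y‖ₑ / ‖WithLp.toLp 2 (Aᵀ *ᵥ y)‖ₑ

lemma enorm_le_ofReal_mul_enorm {E F : Type*} [SeminormedAddGroup E] [SeminormedAddGroup F]
    {x : E} {y : F} {c : ℝ} (hc : 0 ≤ c) :
    ‖x‖ₑ ≤ ENNReal.ofReal c * ‖y‖ₑ ↔ ‖x‖ ≤ c * ‖y‖ := by
  rw [← ofReal_norm, ← ofReal_norm, ← ENNReal.ofReal_mul hc,
    ENNReal.ofReal_le_ofReal_iff (by positivity)]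

lemma dualGain_le_ofReal_iff (A : Matrix (Fin m) (Fin n) ℝ) {c : ℝ} (hc : 0 ≤ c) :
    dualGain A ≤ ENNReal.ofReal c ↔
      ∀ y : Fin m → ℝ, 0 ≤ y → ‖WithLp.toLp 2 y‖ ≤ c * ‖WithLp.toLp 2 (Aᵀ *ᵥ y)‖ := by
  simp only [dualGain, iSup_le_iff]
  refine forall₂_congr fun y _ => ?_
  rw [ENNReal.div_le_iff_le_mul (Or.inr ENNReal.ofReal_ne_top) (Or.inl enorm_ne_top),
    enorm_le_ofReal_mul_enorm hc]

lemma norm_le_dualGain_toReal_mul {A : Matrix (Fin m) (Fin n) ℝ} (h : dualGain A ≠ ⊤)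
    {y : Fin m → ℝ} (hy : 0 ≤ y) :
    ‖WithLp.toLp 2 y‖ ≤ (dualGain A).toReal * ‖WithLp.toLp 2 (Aᵀ *ᵥ y)‖ :=
  (dualGain_le_ofReal_iff A ENNReal.toReal_nonneg).mp (ENNReal.ofReal_toReal h).ge y hy

/-- If `A x ≥ δ > 0` entrywise, then `δ ‖y‖ ≤ δ ∑ yᵢ ≤ (A x) ⬝ᵥ y = x ⬝ᵥ Aᵀ y ≤ ‖x‖ ‖Aᵀ y‖`. -/
lemma dualGain_ne_top {A : Matrix (Fin m) (Fin n) ℝ} (h : ImageMeetsPos A) : dualGain A ≠ ⊤ := by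
  obtain ⟨_, ⟨x, rfl⟩, hx⟩ := h
  replace hx : ∀ i, 0 < (A *ᵥ x) i := hx
  obtain ⟨δ, hδ, hle⟩ : ∃ δ : ℝ, 0 < δ ∧ ∀ i, δ ≤ (A *ᵥ x) i := by
    rcases isEmpty_or_nonempty (Fin m) with _ | _
    · exact ⟨1, one_pos, fun i => isEmptyElim i⟩
    · obtain ⟨i, hi⟩ := Finite.exists_min (A *ᵥ x)
      exact ⟨_, hx i, hi⟩
  refine ne_top_of_le_ne_top ENNReal.ofReal_ne_top
    ((dualGain_le_ofReal_iff A (c := ‖WithLp.toLp 2 x‖ / δ) (by positivity)).mpr fun y hy => ?_)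
  rw [div_mul_eq_mul_div, le_div_iff₀ hδ]
  calc ‖WithLp.toLp 2 y‖ * δ ≤ (∑ i, y i) * δ :=
        mul_le_mul_of_nonneg_right (norm_toLp_le_sum hy) hδ.le
    _ ≤ (A *ᵥ x) ⬝ᵥ y := by
        rw [Finset.sum_mul]
        exact Finset.sum_le_sum fun i _ => by
          rw [mul_comm]; exact mul_le_mul_of_nonneg_right (hle i) (hy i)
    _ ≤ _ := by rw [dotProduct_mulVec_eq]; exact dotProduct_le_norm_mul_norm _ _

/-- The rank-one perturbation `-y yᵀ A / ‖y‖²` makes `y` a certificate of infeasibility. -/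
lemma exists_perturbation (A : Matrix (Fin m) (Fin n) ℝ) {y : Fin m → ℝ} (hy0 : y ≠ 0) :
    ∃ E : Matrix (Fin m) (Fin n) ℝ, (A + E)ᵀ *ᵥ y = 0 ∧
      ‖E‖ ≤ ‖WithLp.toLp 2 (Aᵀ *ᵥ y)‖ / ‖WithLp.toLp 2 y‖ := by
  have hyn : 0 < ‖WithLp.toLp 2 y‖ := norm_pos_iff.mpr (by simpa using hy0)
  set q := Aᵀ *ᵥ y with hq
  refine ⟨-((‖WithLp.toLp 2 y‖ ^ 2)⁻¹ • Matrix.vecMulVec y q), ?_, ?_⟩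
  · rw [Matrix.transpose_add, Matrix.add_mulVec, ← hq, Matrix.transpose_neg, Matrix.neg_mulVec,
      Matrix.transpose_smul, Matrix.smul_mulVec, Matrix.transpose_vecMulVec,
      Matrix.vecMulVec_mulVec, dotProduct_self_eq_norm_sq]
    ext i
    simp
    field_simp
    simp
  · rw [norm_neg]
    refine l2_opNorm_le_of_forall _ (by positivity) fun x => ?_
    rw [Matrix.smul_mulVec, Matrix.vecMulVec_mulVec, op_smul_eq_smul, WithLp.toLp_smul,
      WithLp.toLp_smul, norm_smul, norm_smul, norm_inv, norm_pow, norm_norm, Real.norm_eq_abs]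
    have habs : |q ⬝ᵥ x| ≤ ‖WithLp.toLp 2 q‖ * ‖WithLp.toLp 2 x‖ := by
      refine abs_le'.mpr ⟨dotProduct_le_norm_mul_norm q x, ?_⟩
      have := dotProduct_le_norm_mul_norm (-q) x
      rwa [neg_dotProduct, WithLp.toLp_neg, norm_neg] at this
    calc _ = |q ⬝ᵥ x| / ‖WithLp.toLp 2 y‖ := by field_simp
      _ ≤ _ := by rw [div_mul_eq_mul_div]; gcongr

lemma one_div_renegar (A : Matrix (Fin m) (Fin n) ℝ) : 1 / renegar A = dualGain A := by
  rw [one_div]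
  simp only [renegar, ENNReal.inv_iInf]
  apply le_antisymm
  · refine iSup₂_le fun E hE => ?_
    obtain ⟨y, hy, hy0, hyE⟩ := exists_transpose_mulVec_eq_zero _ hE
    refine le_trans ?_ (le_iSup₂ (f := fun (y : Fin m → ℝ) (_ : 0 ≤ y) =>
      ‖WithLp.toLp 2 y‖ₑ / ‖WithLp.toLp 2 (Aᵀ *ᵥ y)‖ₑ) y hy)
    have hyn : ‖WithLp.toLp 2 y‖ₑ ≠ 0 := by simpa using hy0
    have hle : ‖WithLp.toLp 2 (Aᵀ *ᵥ y)‖ₑ ≤ ‖E‖ₑ * ‖WithLp.toLp 2 y‖ₑ := by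
      rw [← ofReal_norm E, enorm_le_ofReal_mul_enorm (norm_nonneg E), ← l2_opNorm_transpose E]
      have : Aᵀ *ᵥ y = -(Eᵀ *ᵥ y) := by
        rwa [Matrix.transpose_add, Matrix.add_mulVec, add_eq_zero_iff_eq_neg] at hyE
      rw [this, WithLp.toLp_neg, norm_neg]
      exact norm_toLp_mulVec_le _ _
    calc ‖E‖ₑ⁻¹ ≤ (‖WithLp.toLp 2 (Aᵀ *ᵥ y)‖ₑ / ‖WithLp.toLp 2 y‖ₑ)⁻¹ :=
          ENNReal.inv_le_inv.mpr (ENNReal.div_le_of_le_mul hle)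
      _ = _ := ENNReal.inv_div (Or.inl enorm_ne_top) (Or.inl hyn)
  · refine iSup₂_le fun y hy => ?_
    -- The vector `y = 0` contributes `0 / 0 = 0` in `ℝ≥0∞`.
    rcases eq_or_ne y 0 with rfl | hy0
    · simp
    obtain ⟨E, hE, hEn⟩ := exists_perturbation A hy0
    refine le_trans ?_ (le_iSup₂ (f := fun (E : Matrix (Fin m) (Fin n) ℝ)
      (_ : ¬ ImageMeetsPos (A + E)) => ‖E‖ₑ⁻¹) E
        (not_imageMeetsPos_of_transpose_mulVec_eq_zero _ hy hy0 hE))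
    have hyn : 0 < ‖WithLp.toLp 2 y‖ := norm_pos_iff.mpr (by simpa using hy0)
    have hyn' : ‖WithLp.toLp 2 y‖ₑ ≠ 0 := by simpa using hy0
    rw [← ENNReal.inv_div (Or.inl enorm_ne_top) (Or.inl hyn'), ENNReal.inv_le_inv,
      ← ofReal_norm, ← ofReal_norm, ← ofReal_norm, ← ENNReal.ofReal_div_of_pos hyn]
    exact ENNReal.ofReal_le_ofReal hEn

end Gain

/-! ### The Hoffman constant -/

section Hoffman

variable {m n : ℕ}

/-- A short correction `v` comes from solving the residual system `A v ≤ b - A x`. -/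
lemma hoffman_le_dualGain (A : Matrix (Fin m) (Fin n) ℝ) : hoffman A ≤ dualGain A := by
  rcases eq_or_ne (dualGain A) ⊤ with htop | htop
  · rw [htop]; exact le_top
  refine iSup₂_le fun b _ => iSup₂_le fun x _ => ENNReal.div_le_of_le_mul ?_
  obtain ⟨v, hv, hvn⟩ := exists_mulVec_le_of_forall_norm_le A ENNReal.toReal_nonneg
    (fun y hy => norm_le_dualGain_toReal_mul htop hy) (b - A *ᵥ x.ofLp)
  rw [neg_sub] at hvn
  have hmem : x + WithLp.toLp 2 v ∈ polyhedron A b := by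
    change A *ᵥ (x.ofLp + v) ≤ b
    rw [Matrix.mulVec_add]
    exact le_sub_iff_add_le'.mp hv
  refine (Metric.infEDist_le_edist_of_mem hmem).trans ?_
  rw [edist_eq_enorm_sub, sub_add_cancel_left, enorm_neg, ← ENNReal.ofReal_toReal htop,
    enorm_le_ofReal_mul_enorm ENNReal.toReal_nonneg]
  exact hvn

/-- For `b = -y` and `x = 0` the violation is `y` itself, and `A v ≤ -y` forces `‖y‖² ≤ (-A v) ⬝ᵥ y
≤ ‖v‖ ‖Aᵀ y‖`. -/
lemma dualGain_le_hoffman {A : Matrix (Fin m) (Fin n) ℝ} (h : ImageMeetsPos A) :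
    dualGain A ≤ hoffman A := by
  refine iSup₂_le fun y hy => ?_
  rcases eq_or_ne y 0 with rfl | hy0
  · simp
  obtain ⟨_, ⟨g, rfl⟩, hg⟩ := h
  replace hg : ∀ i, 0 < (A *ᵥ g) i := hg
  have hyn : 0 < ‖WithLp.toLp 2 y‖ := norm_pos_iff.mpr (by simpa using hy0)
  have hq : Aᵀ *ᵥ y ≠ 0 := fun h0 =>
    not_imageMeetsPos_of_transpose_mulVec_eq_zero A hy hy0 h0 ⟨_, ⟨g, rfl⟩, hg⟩
  have hqn : 0 < ‖WithLp.toLp 2 (Aᵀ *ᵥ y)‖ := norm_pos_iff.mpr (by simpa using hq)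
  have hb : -y ∈ rightHandSides A := by
    -- A large multiple of `-g` solves `A v ≤ -y`; the sum of the ratios dominates each one.
    obtain ⟨t, ht0, ht⟩ : ∃ t : ℝ, 0 ≤ t ∧ ∀ i, y i ≤ t * (A *ᵥ g) i := by
      refine ⟨∑ i, y i / (A *ᵥ g) i,
        Finset.sum_nonneg fun i _ => div_nonneg (hy i) (hg i).le, fun i => ?_⟩
      rw [← div_le_iff₀ (hg i)]
      exact Finset.single_le_sum (f := fun i => y i / (A *ᵥ g) i)
        (fun j _ => div_nonneg (hy j) (hg j).le) (Finset.mem_univ i)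
    refine ⟨-(t • g), -y + t • (A *ᵥ g), fun i => ?_, ?_⟩
    · simpa using ht i
    · rw [Matrix.mulVec_neg, Matrix.mulVec_smul]; abel
  have hx : (0 : EuclideanSpace ℝ (Fin n)) ∈ (polyhedron A (-y))ᶜ := by
    intro h0
    change A *ᵥ (0 : Fin n → ℝ) ≤ -y at h0
    rw [Matrix.mulVec_zero] at h0
    exact hy0 (le_antisymm (neg_nonneg.mp h0) hy)
  refine le_trans ?_ (le_iSup₂_of_le (-y) hb (le_iSup₂
    (f := fun x (_ : x ∈ (polyhedron A (-y))ᶜ) => Metric.infEDist x (polyhedron A (-y)) /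
      ‖WithLp.toLp 2 ((A *ᵥ x.ofLp - -y)⁺)‖ₑ) 0 hx))
  have hpos : ((A *ᵥ (0 : EuclideanSpace ℝ (Fin n)).ofLp - -y)⁺) = y := by
    rw [WithLp.ofLp_zero, Matrix.mulVec_zero, zero_sub, neg_neg, posPart_of_nonneg hy]
  rw [hpos, ENNReal.le_div_iff_mul_le (Or.inl (by simpa using hy0)) (Or.inl enorm_ne_top)]
  refine Metric.le_infEDist.mpr fun v hv => ?_
  replace hv : A *ᵥ v.ofLp ≤ -y := hv
  rw [edist_zero_left, ← enorm_eq_nnnorm, ← ofReal_norm, ← ofReal_norm, ← ofReal_norm,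
    ← ENNReal.ofReal_div_of_pos hqn, ← ENNReal.ofReal_mul (by positivity)]
  refine ENNReal.ofReal_le_ofReal ?_
  rw [div_mul_eq_mul_div, div_le_iff₀ hqn]
  have h1 : ‖WithLp.toLp 2 y‖ * ‖WithLp.toLp 2 y‖ ≤ (A *ᵥ (-v.ofLp)) ⬝ᵥ y := by
    rw [← sq, ← dotProduct_self_eq_norm_sq, Matrix.mulVec_neg]
    exact dotProduct_le_dotProduct_of_nonneg_right (le_neg_of_le_neg hv) hy
  rw [dotProduct_mulVec_eq] at h1
  have h2 := h1.trans (dotProduct_le_norm_mul_norm _ _)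
  rwa [WithLp.toLp_neg, norm_neg] at h2

end Hoffman

/-! ### The chi constant and signatures -/

section Chi

variable {m n : ℕ}

lemma mulVec_injective_of_rank_eq {A : Matrix (Fin m) (Fin n) ℝ} (hA : A.rank = n) :
    Function.Injective A.mulVec := by
  have h := A.mulVecLin.finrank_range_add_finrank_ker
  rw [← Matrix.rank, hA, Module.finrank_fin_fun, Nat.add_eq_left,
    Submodule.finrank_eq_zero] at h
  exact LinearMap.ker_eq_bot.mp h

lemma isUnit_det_gram {A : Matrix (Fin m) (Fin n) ℝ} (hA : A.rank = n) {d : Fin m → ℝ}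
    (hd : ∀ i, 0 < d i) : IsUnit (Aᵀ * Matrix.diagonal d * A).det := by
  have h := (Matrix.PosDef.diagonal hd).conjTranspose_mul_mul_same (mulVec_injective_of_rank_eq hA)
  rw [Matrix.conjTranspose_eq_transpose_of_trivial] at h
  exact (Matrix.isUnit_iff_isUnit_det _).mp h.isUnit

lemma transpose_weightedPinv (A : Matrix (Fin m) (Fin n) ℝ) (d : Fin m → ℝ) :
    (weightedPinv A (Matrix.diagonal d))ᵀ =
      Matrix.diagonal d * A * (Aᵀ * Matrix.diagonal d * A)⁻¹ := by
  simp only [weightedPinv, Matrix.transpose_mul, Matrix.transpose_nonsing_inv,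
    Matrix.diagonal_transpose, Matrix.transpose_transpose, Matrix.mul_assoc]

/-- Substitute `x = (Aᵀ D A) z`, a bijection, in the norm bound for the transpose. -/
lemma enorm_weightedPinv_le_ofReal_iff {A : Matrix (Fin m) (Fin n) ℝ} (hA : A.rank = n)
    {d : Fin m → ℝ} (hd : ∀ i, 0 < d i) {c : ℝ} (hc : 0 ≤ c) :
    ‖weightedPinv A (Matrix.diagonal d)‖ₑ ≤ ENNReal.ofReal c ↔
      ∀ z : Fin n → ℝ, ‖WithLp.toLp 2 (Matrix.diagonal d *ᵥ (A *ᵥ z))‖ ≤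
        c * ‖WithLp.toLp 2 (Aᵀ *ᵥ (Matrix.diagonal d *ᵥ (A *ᵥ z)))‖ := by
  have hu := isUnit_det_gram hA hd
  set D := Matrix.diagonal d with hD
  rw [← ofReal_norm, ENNReal.ofReal_le_ofReal_iff hc, ← l2_opNorm_transpose, hD,
    transpose_weightedPinv, ← hD]
  constructor
  · intro h z
    have h1 := norm_toLp_mulVec_le (D * A * (Aᵀ * D * A)⁻¹) ((Aᵀ * D * A) *ᵥ z)
    rw [Matrix.mulVec_mulVec, Matrix.mul_assoc _ _ (Aᵀ * D * A), Matrix.nonsing_inv_mul _ hu,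
      Matrix.mul_one] at h1
    simp only [Matrix.mulVec_mulVec, ← Matrix.mul_assoc] at h1 ⊢
    exact h1.trans (mul_le_mul_of_nonneg_right h (norm_nonneg _))
  · intro h
    refine l2_opNorm_le_of_forall _ hc fun x => ?_
    have h1 := h ((Aᵀ * D * A)⁻¹ *ᵥ x)
    simp only [Matrix.mulVec_mulVec, ← Matrix.mul_assoc] at h1
    rwa [Matrix.mul_nonsing_inv _ hu, Matrix.one_mulVec] at h1

/-- Finitely many proper hyperplanes do not cover the space. -/
lemma exists_mulVec_apply_ne_zero {A : Matrix (Fin m) (Fin n) ℝ} (hrow : ∀ i, A.row i ≠ 0) :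
    ∃ g : Fin n → ℝ, ∀ i, (A *ᵥ g) i ≠ 0 := by
  refine Module.Dual.exists_forall_ne_zero_of_forall_exists
    (fun i => LinearMap.proj i ∘ₗ A.mulVecLin) fun i => ⟨A.row i, ?_⟩
  change A.row i ⬝ᵥ A.row i ≠ 0
  rw [Ne, dotProduct_self_eq_zero]
  exact hrow i

/-- The sign pattern of any vector `A z` is compatible with a feasible signature. -/
lemma exists_sign_feasible {A : Matrix (Fin m) (Fin n) ℝ} (hrow : ∀ i, A.row i ≠ 0)
    (z : Fin n → ℝ) :
    ∃ s : Fin m → ℝ, (∀ i, s i = -1 ∨ s i = 1) ∧ (∀ i, 0 ≤ s i * (A *ᵥ z) i) ∧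
      ImageMeetsPos (Matrix.diagonal s * A) := by
  obtain ⟨g, hg⟩ := exists_mulVec_apply_ne_zero hrow
  let σ : ℝ → ℝ := fun t => if 0 < t then 1 else -1
  have hσ : ∀ t, σ t = -1 ∨ σ t = 1 := fun t => by
    simp only [σ]; split_ifs <;> simp
  have hσpos : ∀ t, t ≠ 0 → 0 < σ t * t := fun t ht => by
    simp only [σ]
    split_ifs with h
    · simpa using h
    · simpa using lt_of_le_of_ne (not_lt.mp h) ht
  -- The zero entries of `A z` take their signs from the generic `g`, so `z + ε g` is strictly
  -- feasible for small `ε > 0`.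
  let s : Fin m → ℝ := fun i => if (A *ᵥ z) i = 0 then σ ((A *ᵥ g) i) else σ ((A *ᵥ z) i)
  have hev : ∀ᶠ ε in nhdsWithin (0 : ℝ) (Set.Ioi 0),
      ∀ i, 0 < s i * ((A *ᵥ z) i + ε * (A *ᵥ g) i) := by
    refine Filter.eventually_all.mpr fun i => ?_
    by_cases h0 : (A *ᵥ z) i = 0
    · filter_upwards [self_mem_nhdsWithin] with ε hε
      simp only [s, h0, if_true, zero_add]
      rw [mul_left_comm]
      exact mul_pos hε (hσpos _ (hg i))
    · have hcont : Continuous fun ε : ℝ => s i * ((A *ᵥ z) i + ε * (A *ᵥ g) i) := by fun_prop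
      refine nhdsWithin_le_nhds (hcont.continuousAt.eventually_const_lt ?_)
      simpa [s, h0] using hσpos _ h0
  obtain ⟨ε, hε⟩ := hev.exists
  refine ⟨s, fun i => ?_, fun i => ?_, _, ⟨z + ε • g, rfl⟩, fun i => ?_⟩
  · simp only [s]; split_ifs <;> exact hσ _
  · by_cases h0 : (A *ᵥ z) i = 0
    · simp [h0]
    · simpa [s, h0] using (hσpos _ h0).le
  · simpa [← Matrix.mulVec_mulVec, Matrix.mulVec_diagonal, Matrix.mulVec_add,
      Matrix.mulVec_smul, mul_add, mul_left_comm] using hε i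

lemma transpose_signature_mul_mulVec (A : Matrix (Fin m) (Fin n) ℝ) {s : Fin m → ℝ}
    (hs : ∀ i, s i = -1 ∨ s i = 1) (w : Fin m → ℝ) :
    (Matrix.diagonal s * A)ᵀ *ᵥ (Matrix.diagonal s *ᵥ w) = Aᵀ *ᵥ w := by
  have : Matrix.diagonal s * Matrix.diagonal s = 1 := by
    rw [Matrix.diagonal_mul_diagonal, ← Matrix.diagonal_one]
    congr 1
    ext i
    rcases hs i with h | h <;> simp [h]
  rw [Matrix.transpose_mul, Matrix.diagonal_transpose, Matrix.mulVec_mulVec, Matrix.mul_assoc,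
    this, Matrix.mul_one]

lemma norm_signature_mulVec {s : Fin m → ℝ} (hs : ∀ i, s i = -1 ∨ s i = 1) (w : Fin m → ℝ) :
    ‖WithLp.toLp 2 (Matrix.diagonal s *ᵥ w)‖ = ‖WithLp.toLp 2 w‖ := by
  rw [EuclideanSpace.norm_eq, EuclideanSpace.norm_eq]
  congr 1
  refine Finset.sum_congr rfl fun i _ => ?_
  rcases hs i with h | h <;> simp [Matrix.mulVec_diagonal, h]

lemma chi_le_of_forall_dualGain_le {A : Matrix (Fin m) (Fin n) ℝ} (hA : A.rank = n)
    (hrow : ∀ i, A.row i ≠ 0) {M : ℝ≥0∞}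
    (hM : ∀ S ∈ signatures m, ImageMeetsPos (S * A) → dualGain (S * A) ≤ M) : chi A ≤ M := by
  rcases eq_or_ne M ⊤ with htop | htop
  · rw [htop]; exact le_top
  refine iSup₂_le fun D hD => ?_
  obtain ⟨d, hd, rfl⟩ := hD
  rw [← ENNReal.ofReal_toReal htop, enorm_weightedPinv_le_ofReal_iff hA hd ENNReal.toReal_nonneg]
  intro z
  obtain ⟨s, hs, hsz, hfeas⟩ := exists_sign_feasible hrow z
  have h := hM _ ⟨s, hs, rfl⟩ hfeas
  rw [← ENNReal.ofReal_toReal htop, dualGain_le_ofReal_iff _ ENNReal.toReal_nonneg] at h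
  have h1 := h (Matrix.diagonal s *ᵥ (Matrix.diagonal d *ᵥ (A *ᵥ z))) fun i => by
    rw [Matrix.mulVec_diagonal, Matrix.mulVec_diagonal, mul_left_comm]
    exact mul_nonneg (hd i).le (hsz i)
  rwa [transpose_signature_mul_mulVec A hs, norm_signature_mulVec hs] at h1

lemma dualGain_le_chi {A : Matrix (Fin m) (Fin n) ℝ} (hA : A.rank = n)
    {S : Matrix (Fin m) (Fin m) ℝ} (hS : S ∈ signatures m) (hfeas : ImageMeetsPos (S * A)) :
    dualGain (S * A) ≤ chi A := by
  rcases eq_or_ne (chi A) ⊤ with htop | htop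
  · rw [htop]; exact le_top
  obtain ⟨s, hs, rfl⟩ := hS
  obtain ⟨_, ⟨z, rfl⟩, hz⟩ := hfeas
  replace hz : ∀ i, 0 < s i * (A *ᵥ z) i := fun i => by
    have : 0 < ((Matrix.diagonal s * A) *ᵥ z) i := hz i
    rwa [← Matrix.mulVec_mulVec, Matrix.mulVec_diagonal] at this
  have hss : ∀ i, s i * s i = 1 := fun i => by rcases hs i with h | h <;> simp [h]
  rw [← ENNReal.ofReal_toReal htop, dualGain_le_ofReal_iff _ ENNReal.toReal_nonneg]
  have hpos : ∀ y : Fin m → ℝ, (∀ i, 0 < y i) → ‖WithLp.toLp 2 y‖ ≤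
      (chi A).toReal * ‖WithLp.toLp 2 ((Matrix.diagonal s * A)ᵀ *ᵥ y)‖ := by
    intro y hy
    -- These weights are the ones for which `S D A z = y`.
    set d : Fin m → ℝ := fun i => y i / (s i * (A *ᵥ z) i) with hd
    have hdpos : ∀ i, 0 < d i := fun i => div_pos (hy i) (hz i)
    have hy' : y = Matrix.diagonal s *ᵥ (Matrix.diagonal d *ᵥ (A *ᵥ z)) := by
      ext i
      rw [Matrix.mulVec_diagonal, Matrix.mulVec_diagonal, mul_left_comm, hd,
        div_mul_cancel₀ _ (hz i).ne']
    have h : ‖weightedPinv A (Matrix.diagonal d)‖ₑ ≤ ENNReal.ofReal (chi A).toReal := by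
      rw [ENNReal.ofReal_toReal htop]
      exact le_iSup₂ (f := fun D (_ : D ∈ posDiag m) => ‖weightedPinv A D‖ₑ)
        (Matrix.diagonal d) ⟨d, hdpos, rfl⟩
    rw [hy', transpose_signature_mul_mulVec A hs, norm_signature_mulVec hs]
    exact (enorm_weightedPinv_le_ofReal_iff hA hdpos ENNReal.toReal_nonneg).mp h z
  intro y hy
  -- Boundary points `y ≥ 0` are limits of the positive vectors `y + ε 1`.
  have hcl : ∀ ε : ℝ, 0 < ε → ‖WithLp.toLp 2 (y + ε • 1)‖ ≤
      (chi A).toReal * ‖WithLp.toLp 2 ((Matrix.diagonal s * A)ᵀ *ᵥ (y + ε • 1))‖ :=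
    fun ε hε => hpos _ fun i => by
      have := hy i
      simp only [Pi.add_apply, Pi.smul_apply, Pi.one_apply, smul_eq_mul, mul_one]
      exact add_pos_of_nonneg_of_pos this hε
  have hcont : Continuous fun ε : ℝ => WithLp.toLp 2 (y + ε • (1 : Fin m → ℝ)) := by fun_prop
  have hcont' : Continuous fun ε : ℝ => WithLp.toLp 2
      ((Matrix.diagonal s * A)ᵀ *ᵥ (y + ε • (1 : Fin m → ℝ))) := by fun_prop
  have hlim := le_of_tendsto_of_tendsto (b := nhdsWithin (0 : ℝ) (Set.Ioi 0))
    (hcont.norm.continuousAt.tendsto.mono_left nhdsWithin_le_nhds)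
    ((continuous_const.mul hcont'.norm).continuousAt.tendsto.mono_left nhdsWithin_le_nhds)
    (Filter.eventually_of_mem self_mem_nhdsWithin hcl)
  simpa using hlim

lemma finite_signatures (m : ℕ) : (signatures m).Finite := by
  have h : (Set.univ.pi fun _ : Fin m => ({-1, 1} : Set ℝ)).Finite :=
    Set.Finite.pi fun _ => Set.toFinite _
  refine (h.image Matrix.diagonal).subset ?_
  rintro _ ⟨s, hs, rfl⟩
  exact ⟨s, fun i _ => by simpa using hs i, rfl⟩

lemma isGreatest_chi {A : Matrix (Fin m) (Fin n) ℝ} (hA : A.rank = n)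
    (hrow : ∀ i, A.row i ≠ 0) :
    IsGreatest {r : ℝ≥0∞ | ∃ S ∈ signatures m, ImageMeetsPos (S * A) ∧ r = 1 / renegar (S * A)}
      (chi A) := by
  simp only [one_div_renegar]
  set T : Set (Matrix (Fin m) (Fin m) ℝ) := {S ∈ signatures m | ImageMeetsPos (S * A)} with hT
  have hne : T.Nonempty := by
    -- At `z = 0` the signs are those of a generic vector of the image.
    obtain ⟨s, hs, -, hfeas⟩ := exists_sign_feasible hrow 0
    exact ⟨_, ⟨s, hs, rfl⟩, hfeas⟩
  obtain ⟨S, ⟨hS, hfeas⟩, hmax⟩ := Set.exists_max_image T (fun S => dualGain (S * A))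
    ((finite_signatures m).subset fun S hS => hS.1) hne
  refine ⟨⟨S, hS, hfeas, le_antisymm ?_ (dualGain_le_chi hA hS hfeas)⟩, ?_⟩
  · exact chi_le_of_forall_dualGain_le hA hrow fun S' hS' hfeas' => hmax S' ⟨hS', hfeas'⟩
  · rintro _ ⟨S', hS', hfeas', rfl⟩
    exact dualGain_le_chi hA hS' hfeas'

lemma chi_ne_top {A : Matrix (Fin m) (Fin n) ℝ} (hA : A.rank = n) (hrow : ∀ i, A.row i ≠ 0) :
    chi A ≠ ⊤ := by
  obtain ⟨S, -, hfeas, h⟩ := (isGreatest_chi hA hrow).1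
  rw [h, one_div_renegar]
  exact dualGain_ne_top hfeas

end Chi

end ChiHoffman

theorem proposition5 (m n : ℕ) (A : Matrix (Fin m) (Fin n) ℝ) (hA : A.rank = n) :
    (ChiHoffman.ImageMeetsPos A →
      ChiHoffman.hoffman A ≠ ⊤ ∧ ChiHoffman.hoffman A = 1 / ChiHoffman.renegar A) ∧
    ((∀ i, A.row i ≠ 0) →
      ChiHoffman.chi A ≠ ⊤ ∧
      IsGreatest
        {r : ℝ≥0∞ | ∃ S ∈ ChiHoffman.signatures m,
          ChiHoffman.ImageMeetsPos (S * A) ∧ r = 1 / ChiHoffman.renegar (S * A)}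
        (ChiHoffman.chi A)) := by
  refine ⟨fun h => ?_, fun hrow => ⟨ChiHoffman.chi_ne_top hA hrow,
    ChiHoffman.isGreatest_chi hA hrow⟩⟩
  have heq := le_antisymm (ChiHoffman.hoffman_le_dualGain A) (ChiHoffman.dualGain_le_hoffman h)
  exact ⟨heq ▸ ChiHoffman.dualGain_ne_top h, by rw [heq, ChiHoffman.one_div_renegar]⟩
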